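/- Let $n\ge 1$, $l\ge 0$, $p=l+1$. On $so(2n)$ take the inner product $(U,V)=-\frac1{2n}\operatorname{tr}(UV)$; let $\rho$ be the inner (length) metric on $O(2n)$ of the bi-invariant Riemannian metric with this value at the identity ($\rho=+\infty$ for points in different components). Let $A_1,\dots,A_p$ be real $(2n\times 2n)$-matrices such that $z(x,y)=\big(\sum_{j=1}^p x_jA_j\big)y$ satisfies $|x|^2|y|^2=|z(x,y)|^2$ for all $x\in\mathbb R^p$, $y\in\mathbb R^{2n}$. The set $RS^{l|2n}=\{\sum_j x_jA_j : x\in\mathbb R^{p},\ |x|=1\}$ is called the Radon unit sphere of this form. A Clifford–Killing space $CK_l\subset so(2n)$, $l\ge 1$, is an $l$-dimensional linear space of skew-symmetric matrices $U$ such that each vector field $y\mapsto Uy$ is a Killing vector field of constant length on the round unit sphere $S^{2n-1}$. (1) The map $F:x\mapsto\sum_{j=1}^p x_jA_j$ sends the unit sphere $S^l\subset\mathbb R^{l+1}$ into $O(2n)$, has image $RS^{l|2n}$ and preserves distances: $\rho(F(x),F(y))=\arccos\langle x,y\rangle$ for all $x,y\in S^l$; for $l\ge1$ this is the inner distance of $x,y$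 in the round sphere $S^l$. (2) $RS^{l|2n}$ is an $l$-dimensional totally geodesic submanifold of $(O(2n),\rho)$, and $F$ is an isometry of Riemannian manifolds from the standard unit sphere $S^l$ onto $RS^{l|2n}$ with the induced metric. (3) If $l\ge 1$ and $A_p=I$, then the linear span of $A_1,\dots,A_l$ is a Clifford–Killing space $CK_l\subset so(2n)$, and $RS^{l|2n}=\exp(CK_l)$. (4) Conversely, if $l\ge1$ and $CK_l\subset so(2n)$ is any Clifford–Killing space, then $\exp(CK_l)\subset SO(2n)$, and $\exp(CK_l)$ is the Radon unit sphere $RS^{l|2n}$ of some form as above with $A_p=I$. -/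

import Mathlib

open scoped Matrix ENNReal ContDiff RealInnerProductSpace Matrix.Norms.Frobenius

/-! ### Riemannian geometry of submanifolds of a finite-dimensional vector space

A Riemannian manifold is given by a subset `X` of `E` (an embedded submanifold) and a metric tensor
`g`, where `g x u v` is used only for `x ∈ X` and tangent vectors `u`, `v` of `X` at `x`. -/

section Riemannian

variable {E : Type*} [NormedAddCommGroup E] [NormedSpace ℝ E]
variable {E' : Type*} [NormedAddCommGroup E'] [NormedSpace ℝ E']

/-- The length of the curve `γ` restricted to `[0, 1]` for the metric tensor `g`. -/
noncomputable def curveLength (g : E → E → E → ℝ) (γ : ℝ → E) : ℝ≥0∞ :=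
  ∫⁻ t in Set.Icc (0 : ℝ) 1, ENNReal.ofReal
    (Real.sqrt (g (γ t) (derivWithin γ (Set.Icc 0 1) t) (derivWithin γ (Set.Icc 0 1) t)))

/-- The inner (length) metric of `(X, g)`: the infimum of the lengths of the `C¹` curves in `X`
that join the two points; it is `∞` if there is no such curve. -/
noncomputable def lengthEDist (g : E → E → E → ℝ) (X : Set E) (x y : E) : ℝ≥0∞ :=
  ⨅ (γ : ℝ → E) (_ : ContDiffOn ℝ 1 γ (Set.Icc 0 1)) (_ : ∀ t ∈ Set.Icc (0 : ℝ) 1, γ t ∈ X)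
    (_ : γ 0 = x) (_ : γ 1 = y), curveLength g γ

/-- `u` is a tangent vector of `X` at `x`: the velocity of a smooth curve in `X` through `x`. -/
def IsTangentVector (X : Set E) (x u : E) : Prop :=
  ∃ γ : ℝ → E, ContDiff ℝ ∞ γ ∧ (∀ t, γ t ∈ X) ∧ γ 0 = x ∧ deriv γ 0 = u

/-- `M` is a `d`-dimensional embedded smooth submanifold of `E` (slice charts). -/
def IsSmoothSubmanifold [FiniteDimensional ℝ E] (d : ℕ) (M : Set E) : Prop :=
  ∀ x ∈ M, ∃ (φ : OpenPartialHomeomorph E E) (W : Submodule ℝ E),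
    x ∈ φ.source ∧ ContDiffOn ℝ ∞ φ φ.source ∧ ContDiffOn ℝ ∞ φ.symm φ.target ∧
    Module.finrank ℝ W = d ∧ φ '' (φ.source ∩ M) = φ.target ∩ (W : Set E)

/-- `γ`, defined on the interval `J`, is a geodesic of `(X, g)`: a curve of constant speed that
locally realizes the distance between its points, for the inner metric of `(X, g)`. -/
def IsGeodesicOn (g : E → E → E → ℝ) (X : Set E) (J : Set ℝ) (γ : ℝ → E) : Prop :=
  (∀ t ∈ J, γ t ∈ X) ∧ ∃ v : ℝ, 0 ≤ v ∧ ∀ t ∈ J, ∃ ε > 0, ∀ s ∈ J, ∀ s' ∈ J,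
    |s - t| < ε → |s' - t| < ε → lengthEDist g X (γ s) (γ s') = ENNReal.ofReal (v * |s - s'|)

/-- `M` is a totally geodesic `d`-dimensional submanifold of `(N, g)`: every geodesic of `M`, for
the metric tensor induced by `g`, is a geodesic of `(N, g)`. -/
def IsTotallyGeodesicSubmanifold [FiniteDimensional ℝ E] (d : ℕ) (g : E → E → E → ℝ)
    (M N : Set E) : Prop :=
  IsSmoothSubmanifold d M ∧ M ⊆ N ∧
    ∀ (J : Set ℝ) (γ : ℝ → E), J.OrdConnected → IsGeodesicOn g M J γ → IsGeodesicOn g N J γ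

/-- `f` restricts to an isometry of the Riemannian manifold `(X, g)` onto `(Y, h)`:
a diffeomorphism whose differential preserves the metric tensors. -/
structure IsRiemannianIsometry (g : E → E → E → ℝ) (X : Set E) (h : E' → E' → E' → ℝ)
    (Y : Set E') (f : E → E') : Prop where
  bijOn : Set.BijOn f X Y
  smooth : ∃ U : Set E, IsOpen U ∧ X ⊆ U ∧ ContDiffOn ℝ ∞ f U
  smooth_inverse : ∃ (k : E' → E) (V : Set E'), IsOpen V ∧ Y ⊆ V ∧ ContDiffOn ℝ ∞ k V ∧
    ∀ x ∈ X, k (f x) = x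
  metric : ∀ x ∈ X, ∀ u v : E, IsTangentVector X x u → IsTangentVector X x v →
    h (f x) (fderiv ℝ f x u) (fderiv ℝ f x v) = g x u v

end Riemannian

/-! ### The standard unit spheres and the orthogonal group -/

/-- The unit sphere `S^{m-1}` of `ℝ^m`. -/
def unitSphere (m : ℕ) : Set (EuclideanSpace ℝ (Fin m)) := Metric.sphere 0 1

/-- The metric tensor on `ℝ^m`, and so, by restriction, the canonical one on `S^{m-1}`. -/
noncomputable def euclideanTensor (m : ℕ) (_x u v : EuclideanSpace ℝ (Fin m)) : ℝ := ⟪u, v⟫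

/-- The group `O(m)` as a subset of the space of matrices. -/
def orthogonalSet (m : ℕ) : Set (Matrix (Fin m) (Fin m) ℝ) :=
  Matrix.orthogonalGroup (Fin m) ℝ

/-- The inner product `(U, V) = -(1/m) tr (U V)` on the Lie algebra `so(m)`. -/
noncomputable def soInner {m : ℕ} (U V : Matrix (Fin m) (Fin m) ℝ) : ℝ :=
  -(1 / (m : ℝ)) * (U * V).trace

/-- The bi-invariant metric tensor on `O(m)` which is `soInner` at the identity; tangent vectors
`U`, `V` at `A` are moved to the identity by the left translation by `A⁻¹`. -/
noncomputable def orthogonalTensor {m : ℕ} (A U V : Matrix (Fin m) (Fin m) ℝ) : ℝ :=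
  soInner (A⁻¹ * U) (A⁻¹ * V)

/-- The bi-invariant metric on `O(m)`, with value `∞` for points in different components. -/
noncomputable def orthogonalEDist {m : ℕ} (A B : Matrix (Fin m) (Fin m) ℝ) : ℝ≥0∞ :=
  lengthEDist orthogonalTensor (orthogonalSet m) A B

/-! ### Hurwitz forms, Radon spheres, Clifford-Killing spaces -/

/-- The bilinear function `z(x, y) = ∑ j, x_j (A_j y)`. -/
def matrixForm {p m : ℕ} (A : Fin p → Matrix (Fin m) (Fin m) ℝ) (x : Fin p → ℝ) (y : Fin m → ℝ) :
    Fin m → ℝ :=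
  ∑ j, x j • (A j *ᵥ y)

/-- The matrices `A_j` define a Hurwitz form:
`(x_1² + ⋯ + x_p²) (y_1² + ⋯ + y_m²) = z_1² + ⋯ + z_m²` for `z = z(x, y)`. -/
def IsHurwitzForm {p m : ℕ} (A : Fin p → Matrix (Fin m) (Fin m) ℝ) : Prop :=
  ∀ (x : Fin p → ℝ) (y : Fin m → ℝ),
    (∑ j, x j ^ 2) * (∑ k, y k ^ 2) = ∑ k, (matrixForm A x y k) ^ 2

/-- The map `x ↦ ∑ j, x_j A_j`. -/
def radonMap {p m : ℕ} (A : Fin p → Matrix (Fin m) (Fin m) ℝ) (x : EuclideanSpace ℝ (Fin p)) :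
    Matrix (Fin m) (Fin m) ℝ :=
  ∑ j, x j • A j

/-- Radon's unit sphere: all matrices `∑ j, x_j A_j` with a unit vector `x`. -/
def radonSphere {p m : ℕ} (A : Fin p → Matrix (Fin m) (Fin m) ℝ) :
    Set (Matrix (Fin m) (Fin m) ℝ) :=
  {B | ∃ x : Fin p → ℝ, ∑ j, x j ^ 2 = 1 ∧ B = ∑ j, x j • A j}

/-- `X` restricts to a Killing vector field on `S^{m-1}`: a smooth tangent field such that the Lie
derivative of the canonical metric, `(L_X g)(u, v) = g(∇_u X, v) + g(u, ∇_v X)`, vanishes; here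
`∇_u X` is the tangential part of the derivative of `X` in the direction of `u`. -/
structure IsKillingFieldOnSphere {m : ℕ}
    (X : EuclideanSpace ℝ (Fin m) → EuclideanSpace ℝ (Fin m)) : Prop where
  smooth : ∃ U, IsOpen U ∧ unitSphere m ⊆ U ∧ ContDiffOn ℝ ∞ X U
  tangent : ∀ y ∈ unitSphere m, ⟪y, X y⟫ = 0
  lie_eq_zero : ∀ y ∈ unitSphere m, ∀ u v : EuclideanSpace ℝ (Fin m), ⟪y, u⟫ = 0 → ⟪y, v⟫ = 0 →
    ⟪fderiv ℝ X y u, v⟫ + ⟪u, fderiv ℝ X y v⟫ = 0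

/-- `X` has constant length on `S^{m-1}`. -/
def HasConstantLengthOnSphere {m : ℕ}
    (X : EuclideanSpace ℝ (Fin m) → EuclideanSpace ℝ (Fin m)) : Prop :=
  ∃ c : ℝ, ∀ y ∈ unitSphere m, ‖X y‖ = c

/-- A Clifford-Killing space `CK_l ⊂ so(m)` for `S^{m-1}`: an `l`-dimensional linear space of
skew-symmetric matrices `U`, `l ≥ 1`, such that all vector fields `y ↦ U y` on `S^{m-1}` are Killing
vector fields of constant length. -/
structure IsCliffordKillingSpace {m : ℕ} (l : ℕ) (V : Submodule ℝ (Matrix (Fin m) (Fin m) ℝ)) :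
    Prop where
  one_le : 1 ≤ l
  finrank_eq : Module.finrank ℝ V = l
  le_so : ∀ U ∈ V, U ∈ LieAlgebra.Orthogonal.so (Fin m) ℝ
  killing : ∀ U ∈ V, IsKillingFieldOnSphere fun y => Matrix.toEuclideanLin U y
  constant_length : ∀ U ∈ V, HasConstantLengthOnSphere fun y => Matrix.toEuclideanLin U y

/-- The image of a space of matrices under the matrix exponential map. -/
noncomputable def expImage {m : ℕ} (V : Submodule ℝ (Matrix (Fin m) (Fin m) ℝ)) :
    Set (Matrix (Fin m) (Fin m) ℝ) :=
  NormedSpace.exp '' (V : Set (Matrix (Fin m) (Fin m) ℝ))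

/-! Rescaling matrix entries by 1/√m puts O(m) inside a Euclidean unit sphere, and the bi-invariant
metric becomes the induced one (`orthogonalTensor_eq_inner`). A curve in a unit sphere is at least
as long as the angle between its ends (`angle_le_integral_norm_derivWithin`), so that angle bounds ρ
from below.

The Hurwitz identity says F(x)ᵀF(x) = |x|² I (`isHurwitzForm_iff`). Polarizing and taking traces
shows that F preserves inner products (`IsHurwitzForm.inner_radonMap`). Hence F(S^l) is a great
sphere of the ambient sphere that lies in O(2n); for l ≥ 1 its great circle arcs attain the lower
bound, so distances in RS and in O(2n) both equal the angle. A curve that locally realizes distance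
in RS then does so in O(2n), which is total geodesy in the sense used here. For l = 0 the points ±B
are not joined inside RS; instead an arc cos t B + sin t BJ, with J a complex structure, joins them
in O(2n).

If A_p = I, polarization makes the other A_j skew, and each unit combination J of them satisfies J²
= -I. So exp(tJ) = cos t I + sin t J (`exp_smul_of_mul_self_eq_neg_one`), and these great circles
through I sweep out RS. Conversely, constant length forces UᵀU to be a scalar matrix; evaluation at
one unit vector makes CK_l Euclidean, and an orthonormal basis together with I is a Hurwitz form
(`IsCliffordKillingSpace.exists_isHurwitzForm`). -/

section LengthOnSphere

/-! ### Lengths of curves in unit spheres and comparison of inner distances -/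

variable {H : Type*} [NormedAddCommGroup H] [InnerProductSpace ℝ H]
variable {E : Type*} [NormedAddCommGroup E] [NormedSpace ℝ E]

theorem hasDerivAt_derivWithin_Icc {γ : ℝ → E} (hγ : ContDiffOn ℝ 1 γ (Set.Icc 0 1)) {t : ℝ}
    (ht : t ∈ Set.Ioo (0 : ℝ) 1) : HasDerivAt γ (derivWithin γ (Set.Icc 0 1) t) t :=
  ((hγ.differentiableOn (by simp) t (Set.Ioo_subset_Icc_self ht)).hasDerivWithinAt).hasDerivAt
    (Icc_mem_nhds ht.1 ht.2)

/-- The velocity of a curve in the unit sphere is orthogonal to the position vector. -/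
theorem inner_deriv_eq_zero_of_norm_eq_one {γ : ℝ → H} {s : Set ℝ} {t : ℝ} {v : H}
    (hs : UniqueDiffWithinAt ℝ s t) (hts : t ∈ s) (hγ : HasDerivWithinAt γ v s t)
    (h1 : ∀ t ∈ s, ‖γ t‖ = 1) : ⟪γ t, v⟫ = 0 := by
  have h := hγ.inner ℝ hγ
  have h' : HasDerivWithinAt (fun t => ⟪γ t, γ t⟫) 0 s t :=
    (hasDerivWithinAt_const t s (1 : ℝ)).congr (fun u hu => by simp [h1 u hu])
      (by simp [h1 t hts])
  have := hs.eq_deriv _ h h'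
  rw [real_inner_comm] at this
  linarith [real_inner_comm (γ t) v]

/-- Only the component of `p` orthogonal to `x` pairs with `v`, and it has length √(1 - ⟪p, x⟫²);
then apply Cauchy–Schwarz. This bounds the growth rate of the angle to `p` along a curve. -/
theorem abs_inner_le_norm_mul_sqrt {p x v : H} (hp : ‖p‖ = 1) (hx : ‖x‖ = 1) (hv : ⟪x, v⟫ = 0) :
    |⟪p, v⟫| ≤ ‖v‖ * √(1 - ⟪p, x⟫ ^ 2) := by
  have h1 : ⟪p, v⟫ = ⟪p - ⟪p, x⟫ • x, v⟫ := by
    rw [inner_sub_left, real_inner_smul_left, hv]; ring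
  have h2 : ‖p - ⟪p, x⟫ • x‖ ^ 2 = 1 - ⟪p, x⟫ ^ 2 := by
    rw [norm_sub_sq_real, real_inner_smul_right, norm_smul, hp, hx, Real.norm_eq_abs, mul_one,
      sq_abs]
    ring
  rw [h1, ← h2, Real.sqrt_sq (norm_nonneg _), mul_comm]
  exact abs_real_inner_le_norm _ _

/-- A curve in the unit sphere is at least as long as the angle between its end points. -/
theorem angle_le_integral_norm_derivWithin {γ : ℝ → H} (hγ : ContDiffOn ℝ 1 γ (Set.Icc 0 1))
    (h1 : ∀ t ∈ Set.Icc (0 : ℝ) 1, ‖γ t‖ = 1) :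
    InnerProductGeometry.angle (γ 0) (γ 1) ≤
      ∫ t in (0 : ℝ)..1, ‖derivWithin γ (Set.Icc 0 1) t‖ := by
  have h0 : ‖γ 0‖ = 1 := h1 0 (by simp)
  have hcont : ContinuousOn (fun t => ‖derivWithin γ (Set.Icc 0 1) t‖) (Set.Icc 0 1) :=
    (hγ.continuousOn_derivWithin (uniqueDiffOn_Icc one_pos) le_rfl).norm
  have hf1 : ∀ t ∈ Set.Icc (0 : ℝ) 1, ⟪γ 0, γ t⟫ ^ 2 ≤ 1 := fun t ht => by
    have := abs_real_inner_le_norm (γ 0) (γ t)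
    rw [h0, h1 t ht, mul_one] at this
    exact (sq_le_one_iff_abs_le_one _).2 this
  -- `Real.arccos` is not differentiable at ±1, values which the inner product takes at least at t =
  -- 0. Shrinking the argument by c < 1 avoids them; the limit c → 1 is taken at the end.
  have key : ∀ c ∈ Set.Ioo (0 : ℝ) 1, Real.arccos (c * ⟪γ 0, γ 1⟫) - Real.arccos (c * ⟪γ 0, γ 0⟫) ≤
      ∫ t in (0 : ℝ)..1, ‖derivWithin γ (Set.Icc 0 1) t‖ := by
    rintro c ⟨hc0, hc1⟩
    have hc : ∀ t ∈ Set.Icc (0 : ℝ) 1, (c * ⟪γ 0, γ t⟫) ^ 2 < 1 := fun t ht => by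
      rw [mul_pow]
      exact (mul_le_of_le_one_right (sq_nonneg c) (hf1 t ht)).trans_lt
        (pow_lt_one₀ hc0.le hc1 two_ne_zero)
    refine intervalIntegral.sub_le_integral_of_hasDeriv_right_of_le
      (g := fun t => Real.arccos (c * ⟪γ 0, γ t⟫))
      (g' := fun t => -(1 / √(1 - (c * ⟪γ 0, γ t⟫) ^ 2)) *
        (c * ⟪γ 0, derivWithin γ (Set.Icc 0 1) t⟫)) zero_le_one ?_ ?_
      hcont.integrableOn_Icc ?_
    · exact Real.continuous_arccos.comp_continuousOn
        (continuousOn_const.mul (continuousOn_const.inner hγ.continuousOn))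
    · intro t ht
      have hd := hasDerivAt_derivWithin_Icc hγ ht
      have hlt := hc t (Set.Ioo_subset_Icc_self ht)
      have hin : HasDerivAt (fun t => c * ⟪γ 0, γ t⟫)
          (c * ⟪γ 0, derivWithin γ (Set.Icc 0 1) t⟫) t := by
        have := ((hasDerivAt_const t (γ 0)).inner ℝ hd).const_mul c
        simpa using this
      refine (HasDerivAt.comp t (Real.hasDerivAt_arccos ?_ ?_) hin).hasDerivWithinAt
      · intro h; rw [h] at hlt; norm_num at hlt
      · intro h; rw [h] at hlt; norm_num at hlt
    · intro t ht
      have htI := Set.Ioo_subset_Icc_self ht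
      have hd := hasDerivAt_derivWithin_Icc hγ ht
      have horth := inner_deriv_eq_zero_of_norm_eq_one
        (uniqueDiffOn_Icc one_pos t htI) htI hd.hasDerivWithinAt h1
      have hb := abs_inner_le_norm_mul_sqrt h0 (h1 t htI) horth
      have hlt := hc t htI
      have hpos : 0 < √(1 - (c * ⟪γ 0, γ t⟫) ^ 2) := Real.sqrt_pos.2 (by linarith)
      have hcs : c * √(1 - ⟪γ 0, γ t⟫ ^ 2) ≤ √(1 - (c * ⟪γ 0, γ t⟫) ^ 2) := by
        apply Real.le_sqrt_of_sq_le
        rw [mul_pow, Real.sq_sqrt (by linarith [hf1 t htI])]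
        nlinarith
      calc -(1 / √(1 - (c * ⟪γ 0, γ t⟫) ^ 2)) * (c * ⟪γ 0, derivWithin γ (Set.Icc 0 1) t⟫)
          = (c * -⟪γ 0, derivWithin γ (Set.Icc 0 1) t⟫) / √(1 - (c * ⟪γ 0, γ t⟫) ^ 2) := by ring
        _ ≤ ‖derivWithin γ (Set.Icc 0 1) t‖ := by
          rw [div_le_iff₀ hpos]
          calc c * -⟪γ 0, derivWithin γ (Set.Icc 0 1) t⟫
              ≤ c * (‖derivWithin γ (Set.Icc 0 1) t‖ * √(1 - ⟪γ 0, γ t⟫ ^ 2)) := by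
                gcongr; exact (neg_le_abs _).trans hb
            _ = ‖derivWithin γ (Set.Icc 0 1) t‖ * (c * √(1 - ⟪γ 0, γ t⟫ ^ 2)) := by ring
            _ ≤ _ := by gcongr
  have hlim : Filter.Tendsto
      (fun c : ℝ => Real.arccos (c * ⟪γ 0, γ 1⟫) - Real.arccos (c * ⟪γ 0, γ 0⟫))
      (nhdsWithin 1 (Set.Iio 1))
      (nhds (Real.arccos (1 * ⟪γ 0, γ 1⟫) - Real.arccos (1 * ⟪γ 0, γ 0⟫))) := by
    refine (Continuous.tendsto ?_ 1).mono_left nhdsWithin_le_nhds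
    exact (Real.continuous_arccos.comp (continuous_id.mul continuous_const)).sub
      (Real.continuous_arccos.comp (continuous_id.mul continuous_const))
  have hle := le_of_tendsto hlim
    (Filter.mem_of_superset (Ioo_mem_nhdsLT (show (0 : ℝ) < 1 by norm_num)) key)
  simpa [InnerProductGeometry.angle, h0, h1 1 (by simp)] using hle

/-- If a linear map sends `X` to the unit sphere and the velocities of curves in `X` isometrically,
then it does not increase the distances. -/
theorem angle_le_lengthEDist {g : E → E → E → ℝ} {X : Set E} (L : E →L[ℝ] H)
    (hX : ∀ x ∈ X, ‖L x‖ = 1)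
    (hg : ∀ γ : ℝ → E, ContDiffOn ℝ 1 γ (Set.Icc 0 1) → (∀ t ∈ Set.Icc (0 : ℝ) 1, γ t ∈ X) →
      ∀ t ∈ Set.Icc (0 : ℝ) 1,
        g (γ t) (derivWithin γ (Set.Icc 0 1) t) (derivWithin γ (Set.Icc 0 1) t) =
          ‖L (derivWithin γ (Set.Icc 0 1) t)‖ ^ 2) (x y : E) :
    ENNReal.ofReal (InnerProductGeometry.angle (L x) (L y)) ≤ lengthEDist g X x y := by
  refine le_iInf fun γ => le_iInf fun hγ => le_iInf fun hmem => le_iInf fun h0 =>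
    le_iInf fun h1 => ?_
  have hLγ : ContDiffOn ℝ 1 (fun t => L (γ t)) (Set.Icc 0 1) := L.contDiff.comp_contDiffOn hγ
  have hder : ∀ t ∈ Set.Icc (0 : ℝ) 1, derivWithin (fun t => L (γ t)) (Set.Icc 0 1) t =
      L (derivWithin γ (Set.Icc 0 1) t) := fun t ht =>
    (L.hasFDerivAt.comp_hasDerivWithinAt t
      (hγ.differentiableOn (by simp) t ht).hasDerivWithinAt).derivWithin
      (uniqueDiffOn_Icc one_pos t ht)
  have hcont : ContinuousOn (fun t => ‖derivWithin (fun t => L (γ t)) (Set.Icc 0 1) t‖)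
      (Set.Icc 0 1) :=
    (hLγ.continuousOn_derivWithin (uniqueDiffOn_Icc one_pos) le_rfl).norm
  have hmain := angle_le_integral_norm_derivWithin hLγ (fun t ht => hX _ (hmem t ht))
  rw [h0, h1, intervalIntegral.integral_of_le zero_le_one,
    ← MeasureTheory.integral_Icc_eq_integral_Ioc] at hmain
  refine (ENNReal.ofReal_le_ofReal hmain).trans ?_
  rw [MeasureTheory.ofReal_integral_eq_lintegral_ofReal hcont.integrableOn_Icc
    (Filter.Eventually.of_forall fun t => norm_nonneg _)]
  refine (MeasureTheory.setLIntegral_congr_fun measurableSet_Icc fun t ht => ?_).le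
  simp only [hg γ hγ hmem t ht, hder t ht, Real.sqrt_sq (norm_nonneg _)]

/-- The arc `t ↦ cos t • b + sin t • c` of length `θ` bounds the distance of its end points. -/
theorem lengthEDist_cos_sin_le {g : E → E → E → ℝ} {X : Set E} {b c : E} {θ : ℝ} (hθ : 0 ≤ θ)
    (hX : ∀ t : ℝ, Real.cos t • b + Real.sin t • c ∈ X)
    (hg : ∀ t : ℝ, g (Real.cos t • b + Real.sin t • c)
      (θ • (-Real.sin t • b + Real.cos t • c)) (θ • (-Real.sin t • b + Real.cos t • c)) = θ ^ 2) :
    lengthEDist g X b (Real.cos θ • b + Real.sin θ • c) ≤ ENNReal.ofReal θ := by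
  let γ : ℝ → E := fun t => Real.cos (θ * t) • b + Real.sin (θ * t) • c
  have hγ : ContDiff ℝ 1 γ :=
    ((Real.contDiff_cos.comp (contDiff_const.mul contDiff_id)).smul contDiff_const).add
      ((Real.contDiff_sin.comp (contDiff_const.mul contDiff_id)).smul contDiff_const)
  have hd : ∀ t, HasDerivAt γ (θ • (-Real.sin (θ * t) • b + Real.cos (θ * t) • c)) t := fun t => by
    have hl : HasDerivAt (fun t => θ * t) θ t := by simpa using (hasDerivAt_id t).const_mul θ
    exact ((hl.cos.smul_const b).add (hl.sin.smul_const c)).congr_deriv (by module)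
  unfold lengthEDist
  refine le_trans (b := curveLength g γ) (iInf_le_of_le γ <| iInf_le_of_le hγ.contDiffOn <|
    iInf_le_of_le (fun t _ => hX _) <| iInf_le_of_le (by simp [γ]) <|
    iInf_le_of_le (by simp [γ]) le_rfl) ?_
  refine (MeasureTheory.setLIntegral_congr_fun (g := fun _ => ENNReal.ofReal θ)
    measurableSet_Icc fun t ht => ?_).le.trans (by simp)
  simp only [(hd t).hasDerivWithinAt.derivWithin (uniqueDiffOn_Icc one_pos t ht)]
  rw [show γ t = Real.cos (θ * t) • b + Real.sin (θ * t) • c from rfl, hg, Real.sqrt_sq hθ]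

theorem lengthEDist_anti {g : E → E → E → ℝ} {X Y : Set E} (h : X ⊆ Y) (x y : E) :
    lengthEDist g Y x y ≤ lengthEDist g X x y :=
  iInf_mono fun _ => iInf_mono fun _ => iInf_mono' fun hm => ⟨fun t ht => h (hm t ht), le_rfl⟩

/-- If the inner distance of `M` agrees with that of `N` wherever it is finite, then `M` inherits
the geodesics of `N`. -/
theorem IsGeodesicOn.mono_of_lengthEDist_eq {g : E → E → E → ℝ} {M N : Set E} (hMN : M ⊆ N)
    (h : ∀ x ∈ M, ∀ y ∈ M, lengthEDist g M x y ≠ ⊤ → lengthEDist g N x y = lengthEDist g M x y)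
    {J : Set ℝ} {γ : ℝ → E} (hγ : IsGeodesicOn g M J γ) : IsGeodesicOn g N J γ := by
  obtain ⟨hM, v, hv, hloc⟩ := hγ
  refine ⟨fun t ht => hMN (hM t ht), v, hv, fun t ht => ?_⟩
  obtain ⟨ε, hε, H⟩ := hloc t ht
  refine ⟨ε, hε, fun s hs s' hs' h1 h2 => ?_⟩
  have := H s hs s' hs' h1 h2
  rw [h _ (hM s hs) _ (hM s' hs') (by rw [this]; exact ENNReal.ofReal_ne_top), this]

/-- Two unit vectors lie on a common great circle. -/
theorem exists_eq_cos_smul_add_sin_smul {x y : H} (hx : ‖x‖ = 1) (hy : ‖y‖ = 1)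
    (hdim : ∃ u : H, ‖u‖ = 1 ∧ ⟪x, u⟫ = 0) :
    ∃ u : H, ‖u‖ = 1 ∧ ⟪x, u⟫ = 0 ∧
      y = Real.cos (InnerProductGeometry.angle x y) • x +
        Real.sin (InnerProductGeometry.angle x y) • u := by
  set θ := InnerProductGeometry.angle x y with hθ
  have hcos : Real.cos θ = ⟪x, y⟫ := by
    rw [hθ, InnerProductGeometry.cos_angle, hx, hy]; simp
  have hw : ‖y - Real.cos θ • x‖ ^ 2 = Real.sin θ ^ 2 := by
    rw [norm_sub_sq_real, real_inner_smul_right, norm_smul, hx, hy, Real.norm_eq_abs, mul_one,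
      sq_abs, real_inner_comm, ← hcos, Real.sin_sq]
    ring
  -- If sin θ = 0 then y = ±x does not determine a great circle, so any unit vector orthogonal to x
  -- serves; this is where `hdim` is needed. Otherwise normalize the component of y orthogonal to x.
  by_cases hs : Real.sin θ = 0
  · obtain ⟨u, hu1, hu2⟩ := hdim
    refine ⟨u, hu1, hu2, ?_⟩
    rw [hs] at hw ⊢
    have : y - Real.cos θ • x = 0 := by simpa using hw
    rw [zero_smul, add_zero]
    exact sub_eq_zero.1 this
  · have hspos : 0 < Real.sin θ :=
      lt_of_le_of_ne (InnerProductGeometry.sin_angle_nonneg x y) (Ne.symm hs)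
    have hn : ‖y - Real.cos θ • x‖ = Real.sin θ :=
      (pow_left_inj₀ (norm_nonneg _) hspos.le two_ne_zero).1 hw
    refine ⟨(Real.sin θ)⁻¹ • (y - Real.cos θ • x), ?_, ?_, ?_⟩
    · rw [norm_smul, hn, Real.norm_eq_abs, abs_of_pos (inv_pos.2 hspos), inv_mul_cancel₀ hs]
    · rw [real_inner_smul_right, inner_sub_right, real_inner_smul_right, real_inner_self_eq_norm_sq,
        hx, hcos]
      ring
    · rw [smul_smul, mul_inv_cancel₀ hs]; module

end LengthOnSphere

/-! ### Slice charts for linearly embedded spheres -/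

section Submanifold

variable {E : Type*} [NormedAddCommGroup E] [NormedSpace ℝ E] [FiniteDimensional ℝ E]
variable {V : Type*} [NormedAddCommGroup V] [InnerProductSpace ℝ V]

/-- The image of the unit sphere under a linear embedding is a submanifold; near the image of `e`
it is flattened by a projection along `e`. -/
theorem isSmoothSubmanifold_image_sphere {l : ℕ} (hV : Module.finrank ℝ V = l + 1) (F : V →L[ℝ] E)
    (P : E →L[ℝ] V) (hPF : ∀ v, P (F v) = v) :
    IsSmoothSubmanifold l (F '' Metric.sphere (0 : V) 1) := by
  rintro _ ⟨e, he, rfl⟩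
  have he1 : ‖e‖ = 1 := by simpa using he
  have hee : ⟪e, e⟫ = 1 := by rw [real_inner_self_eq_norm_sq, he1]; norm_num
  -- `a` is the height of `P y` in the direction e, and `q` is the squared length of the component
  -- of `P y` orthogonal to e. Translation along `F e` shifts `a` and fixes `q`.
  let a : E → ℝ := fun y => ⟪e, P y⟫
  let q : E → ℝ := fun y => ‖P y‖ ^ 2 - a y ^ 2
  have ha : ContDiff ℝ ∞ a := contDiff_const.inner ℝ P.contDiff
  have hq : ContDiff ℝ ∞ q := (P.contDiff.norm_sq ℝ).sub (ha.pow 2)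
  have ha_add : ∀ y (t : ℝ), a (y + t • F e) = a y + t := fun y t => by
    simp only [a, map_add, map_smul, hPF, inner_add_right, real_inner_smul_right, hee, mul_one]
  have hq_add : ∀ y (t : ℝ), q (y + t • F e) = q y := fun y t => by
    simp only [q, ha_add]
    simp only [map_add, map_smul, hPF, norm_add_sq_real, norm_smul, he1, real_inner_smul_right, a,
      Real.norm_eq_abs, mul_one, sq_abs, real_inner_comm e]
    ring
  have ha_sub : ∀ y (t : ℝ), a (y - t • F e) = a y - t := fun y t => by
    rw [sub_eq_add_neg, ← neg_smul, ha_add]; ring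
  have hq_sub : ∀ y (t : ℝ), q (y - t • F e) = q y := fun y t => by
    rw [sub_eq_add_neg, ← neg_smul, hq_add]
  let S : Set E := {y | q y < 1} ∩ {y | 0 < a y}
  let T : Set E := {y | q y < 1} ∩ {y | 0 < a y + √(1 - q y)}
  have hs : Continuous fun y => √(1 - q y) := (continuous_const.sub hq.continuous).sqrt
  have hsd : ContDiffOn ℝ ∞ (fun y => √(1 - q y)) {y | q y < 1} :=
    (contDiff_const.sub hq).contDiffOn.sqrt fun y hy => by
      have : q y < 1 := hy
      linarith
  -- A shear along `F e` that lowers the hemisphere a = √(1 - q) to a = 0. Since `q` is unchanged,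
  -- the inverse is the opposite shear.
  let φ : OpenPartialHomeomorph E E :=
    { toFun := fun y => y - √(1 - q y) • F e
      invFun := fun y => y + √(1 - q y) • F e
      source := S
      target := T
      map_source' := fun y hy => by
        refine ⟨?_, ?_⟩
        · simpa only [Set.mem_ofPred_eq, hq_sub] using hy.1
        · simpa only [Set.mem_ofPred_eq, hq_sub, ha_sub, sub_add_cancel] using hy.2
      map_target' := fun y hy => by
        refine ⟨?_, ?_⟩
        · simpa only [Set.mem_ofPred_eq, hq_add] using hy.1
        · simpa only [Set.mem_ofPred_eq, ha_add] using hy.2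
      left_inv' := fun y _ => by simp only [hq_sub, sub_add_cancel]
      right_inv' := fun y _ => by simp only [hq_add, add_sub_cancel_right]
      continuousOn_toFun := (continuous_id.sub (hs.smul continuous_const)).continuousOn
      continuousOn_invFun := (continuous_id.add (hs.smul continuous_const)).continuousOn
      open_source := (isOpen_lt hq.continuous continuous_const).inter
        (isOpen_lt continuous_const ha.continuous)
      open_target := (isOpen_lt hq.continuous continuous_const).inter
        (isOpen_lt continuous_const (ha.continuous.add hs)) }
  have hF : Function.Injective F := Function.LeftInverse.injective hPF
  refine ⟨φ, ((ℝ ∙ e)ᗮ).map F.toLinearMap, ?_, ?_, ?_, ?_, ?_⟩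
  · refine ⟨?_, ?_⟩ <;> simp [q, a, hPF, he1]
  · exact contDiffOn_id.sub ((hsd.mono Set.inter_subset_left).smul contDiffOn_const)
  · exact contDiffOn_id.add ((hsd.mono Set.inter_subset_left).smul contDiffOn_const)
  · have : Fact (Module.finrank ℝ V = l + 1) := ⟨hV⟩
    rw [← (Submodule.equivMapOfInjective F.toLinearMap hF _).finrank_eq]
    exact Submodule.finrank_orthogonal_span_singleton (by rintro rfl; simp at he1)
  · ext y
    constructor
    · rintro ⟨_, ⟨hyS, v, hv, rfl⟩, rfl⟩
      refine ⟨φ.map_source hyS, ?_⟩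
      have hv1 : ‖v‖ = 1 := by simpa using hv
      have hpos : 0 < ⟪e, v⟫ := by simpa only [a, S, Set.mem_ofPred_eq, hPF] using hyS.2
      refine ⟨v - ⟪e, v⟫ • e, ?_, ?_⟩
      · rw [SetLike.mem_coe, Submodule.mem_orthogonal_singleton_iff_inner_right]
        rw [inner_sub_right, real_inner_smul_right, hee]; ring
      · change F (v - ⟪e, v⟫ • e) = F v - √(1 - q (F v)) • F e
        have : 1 - q (F v) = ⟪e, v⟫ ^ 2 := by simp only [q, a, hPF, hv1]; ring
        rw [this, Real.sqrt_sq hpos.le, map_sub, map_smul]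
    · rintro ⟨hyT, w, hw, rfl⟩
      rw [SetLike.mem_coe, Submodule.mem_orthogonal_singleton_iff_inner_right] at hw
      refine ⟨φ.symm (F w), ⟨φ.map_target hyT, w + √(1 - q (F w)) • e, ?_, ?_⟩,
        φ.right_inv hyT⟩
      · have hlt : q (F w) < 1 := hyT.1
        have hqw : q (F w) = ‖w‖ ^ 2 := by simp only [q, a, hPF, hw]; ring
        have h2 : ‖w + √(1 - q (F w)) • e‖ ^ 2 = 1 := by
          rw [norm_add_sq_real, real_inner_smul_right, real_inner_comm, hw, norm_smul, he1,
            Real.norm_eq_abs, mul_one, sq_abs, Real.sq_sqrt (by linarith), hqw]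
          ring
        rw [mem_sphere_zero_iff_norm]
        exact (pow_eq_one_iff_of_nonneg (norm_nonneg _) two_ne_zero).1 h2
      · change F (w + √(1 - q (F w)) • e) = F w + √(1 - q (F w)) • F e
        rw [map_add, map_smul]

end Submanifold

/-! ### The orthogonal group inside a Euclidean unit sphere -/

section OrthogonalGroup

variable {m : ℕ}

/-- The embedding of the space of matrices into a Euclidean space by the entries, rescaled so that
`O(m)` lies in the unit sphere. -/
noncomputable def matrixToEuclidean (m : ℕ) :
    Matrix (Fin m) (Fin m) ℝ →L[ℝ] EuclideanSpace ℝ (Fin m × Fin m) :=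
  LinearMap.toContinuousLinearMap
    { toFun := fun B => WithLp.toLp 2 fun i => (√(m : ℝ))⁻¹ * B i.1 i.2
      map_add' := fun B C => by ext i; simp [mul_add]
      map_smul' := fun c B => by ext i; simp; ring }

theorem inner_matrixToEuclidean (B C : Matrix (Fin m) (Fin m) ℝ) :
    ⟪matrixToEuclidean m B, matrixToEuclidean m C⟫ = 1 / (m : ℝ) * (Bᵀ * C).trace := by
  have h : (√(m : ℝ))⁻¹ * (√(m : ℝ))⁻¹ = 1 / (m : ℝ) := by
    rw [← mul_inv, Real.mul_self_sqrt (Nat.cast_nonneg m), one_div]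
  rw [PiLp.inner_apply, Fintype.sum_prod_type_right, Matrix.trace, Finset.mul_sum]
  refine Finset.sum_congr rfl fun j _ => ?_
  rw [Matrix.diag_apply, Matrix.mul_apply, Finset.mul_sum]
  refine Finset.sum_congr rfl fun i _ => ?_
  simp only [matrixToEuclidean, LinearMap.coe_toContinuousLinearMap', LinearMap.coe_mk,
    AddHom.coe_mk, RCLike.inner_apply, conj_trivial, Matrix.transpose_apply, ← h]
  ring

theorem norm_matrixToEuclidean_of_mem_orthogonalSet (hm : m ≠ 0) {B : Matrix (Fin m) (Fin m) ℝ}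
    (hB : B ∈ orthogonalSet m) : ‖matrixToEuclidean m B‖ = 1 := by
  have h : Bᵀ * B = 1 := (Matrix.mem_orthogonalGroup_iff' (Fin m) ℝ).1 hB
  have h2 : ‖matrixToEuclidean m B‖ ^ 2 = 1 := by
    rw [← real_inner_self_eq_norm_sq, inner_matrixToEuclidean, h, Matrix.trace_one, Fintype.card_fin]
    field_simp
  exact (pow_eq_one_iff_of_nonneg (norm_nonneg _) two_ne_zero).1 h2

/-- On tangent vectors of `O(m)` the bi-invariant metric is the rescaled Frobenius product. -/
theorem orthogonalTensor_eq_inner {A U : Matrix (Fin m) (Fin m) ℝ} (hA : Aᵀ * A = 1)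
    (hU : (Aᵀ * U)ᵀ = -(Aᵀ * U)) (V : Matrix (Fin m) (Fin m) ℝ) :
    orthogonalTensor A U V = ⟪matrixToEuclidean m U, matrixToEuclidean m V⟫ := by
  have hA' : A * Aᵀ = 1 := mul_eq_one_comm.1 hA
  have h : Uᵀ * V = -(Aᵀ * U * (Aᵀ * V)) := by
    rw [← neg_mul, ← hU, Matrix.transpose_mul, Matrix.transpose_transpose, Matrix.mul_assoc,
      ← Matrix.mul_assoc A, hA', Matrix.one_mul]
  rw [inner_matrixToEuclidean, h, orthogonalTensor, soInner, Matrix.inv_eq_left_inv hA,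
    Matrix.trace_neg]
  ring

/-- Differentiate γᵀγ = 1. This is the hypothesis under which the bi-invariant tensor is the
rescaled Frobenius product. -/
theorem transpose_mul_deriv_skew {γ : ℝ → Matrix (Fin m) (Fin m) ℝ} {s : Set ℝ} {t : ℝ}
    {U : Matrix (Fin m) (Fin m) ℝ} (hs : UniqueDiffWithinAt ℝ s t) (hts : t ∈ s)
    (hγ : HasDerivWithinAt γ U s t) (hO : ∀ t ∈ s, γ t ∈ orthogonalSet m) :
    ((γ t)ᵀ * U)ᵀ = -((γ t)ᵀ * U) := by
  have hO' : ∀ t ∈ s, (γ t)ᵀ * γ t = 1 := fun t ht =>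
    (Matrix.mem_orthogonalGroup_iff' (Fin m) ℝ).1 (hO t ht)
  let T : Matrix (Fin m) (Fin m) ℝ →L[ℝ] Matrix (Fin m) (Fin m) ℝ :=
    LinearMap.toContinuousLinearMap (Matrix.transposeLinearEquiv (Fin m) (Fin m) ℝ ℝ).toLinearMap
  have hT : HasDerivWithinAt (fun t => (γ t)ᵀ) Uᵀ s t :=
    T.hasFDerivAt.comp_hasDerivWithinAt t hγ
  have h1 : HasDerivWithinAt (fun t => (γ t)ᵀ * γ t) (Uᵀ * γ t + (γ t)ᵀ * U) s t := hT.mul hγ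
  have h2 : HasDerivWithinAt (fun t => (γ t)ᵀ * γ t) 0 s t :=
    (hasDerivWithinAt_const t s (1 : Matrix (Fin m) (Fin m) ℝ)).congr (fun u hu => hO' u hu)
      (hO' t hts)
  rw [Matrix.transpose_mul, Matrix.transpose_transpose]
  exact eq_neg_of_add_eq_zero_left (hs.eq_deriv _ h1 h2)

/-- The distance in `O(m)` is bounded below by the angle in the ambient Euclidean space. -/
theorem angle_le_orthogonalEDist (hm : m ≠ 0) (A B : Matrix (Fin m) (Fin m) ℝ) :
    ENNReal.ofReal (InnerProductGeometry.angle (matrixToEuclidean m A) (matrixToEuclidean m B)) ≤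
      orthogonalEDist A B := by
  refine angle_le_lengthEDist (matrixToEuclidean m)
    (fun x hx => norm_matrixToEuclidean_of_mem_orthogonalSet hm hx) (fun γ hγ hO t ht => ?_) A B
  have hskew := transpose_mul_deriv_skew (uniqueDiffOn_Icc one_pos t ht) ht
    (hγ.differentiableOn (by simp) t ht).hasDerivWithinAt hO
  rw [orthogonalTensor_eq_inner ((Matrix.mem_orthogonalGroup_iff' (Fin m) ℝ).1 (hO t ht)) hskew,
    real_inner_self_eq_norm_sq]
  rfl

end OrthogonalGroup

/-! ### Great circles and the inner distance of the round sphere -/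

section Sphere

theorem exists_unit_orthogonal {l : ℕ} (hl : 1 ≤ l) {x : EuclideanSpace ℝ (Fin (l + 1))}
    (hx : ‖x‖ = 1) : ∃ u : EuclideanSpace ℝ (Fin (l + 1)), ‖u‖ = 1 ∧ ⟪x, u⟫ = 0 := by
  have : Fact (Module.finrank ℝ (EuclideanSpace ℝ (Fin (l + 1))) = l + 1) := ⟨by simp⟩
  have hfin : Module.finrank ℝ (ℝ ∙ x)ᗮ = l :=
    Submodule.finrank_orthogonal_span_singleton (by rintro rfl; simp at hx)
  have : Nontrivial (ℝ ∙ x)ᗮ := Module.nontrivial_of_finrank_pos (R := ℝ) (by omega)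
  obtain ⟨⟨w, hw⟩, hw0⟩ := exists_ne (0 : (ℝ ∙ x)ᗮ)
  have hwne : w ≠ 0 := fun h => hw0 (Subtype.ext h)
  refine ⟨‖w‖⁻¹ • w, by rw [norm_smul, norm_inv, norm_norm, inv_mul_cancel₀ (norm_ne_zero_iff.2 hwne)], ?_⟩
  rw [real_inner_smul_right, Submodule.mem_orthogonal_singleton_iff_inner_right.1 hw, mul_zero]

theorem norm_cos_smul_add_sin_smul {V : Type*} [NormedAddCommGroup V] [InnerProductSpace ℝ V]
    {x u : V} (hx : ‖x‖ = 1) (hu : ‖u‖ = 1) (hxu : ⟪x, u⟫ = 0) (t : ℝ) :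
    ‖Real.cos t • x + Real.sin t • u‖ = 1 := by
  have h : ‖Real.cos t • x + Real.sin t • u‖ ^ 2 = 1 := by
    rw [norm_add_sq_real, real_inner_smul_left, real_inner_smul_right, hxu, norm_smul, norm_smul,
      hx, hu, Real.norm_eq_abs, Real.norm_eq_abs, mul_one, mul_one, sq_abs, sq_abs]
    linarith [Real.sin_sq_add_cos_sq t]
  exact (pow_eq_one_iff_of_nonneg (norm_nonneg _) two_ne_zero).1 h

/-- Up to the factor θ, the velocity at t is the point of the same circle at t + π/2. -/
theorem norm_smul_neg_sin_smul_add_cos_smul {V : Type*} [NormedAddCommGroup V]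
    [InnerProductSpace ℝ V] {x u : V} (hx : ‖x‖ = 1) (hu : ‖u‖ = 1) (hxu : ⟪x, u⟫ = 0) (θ t : ℝ) :
    ‖θ • (-Real.sin t • x + Real.cos t • u)‖ ^ 2 = θ ^ 2 := by
  have := norm_cos_smul_add_sin_smul hx hu hxu (t + Real.pi / 2)
  rw [Real.cos_add_pi_div_two, Real.sin_add_pi_div_two] at this
  rw [norm_smul, this, mul_one, Real.norm_eq_abs, sq_abs]

/-- The inner distance of the round sphere is the angle. -/
theorem lengthEDist_unitSphere {l : ℕ} (hl : 1 ≤ l) {x y : EuclideanSpace ℝ (Fin (l + 1))}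
    (hx : x ∈ unitSphere (l + 1)) (hy : y ∈ unitSphere (l + 1)) :
    lengthEDist (euclideanTensor (l + 1)) (unitSphere (l + 1)) x y =
      ENNReal.ofReal (InnerProductGeometry.angle x y) := by
  rw [unitSphere, mem_sphere_zero_iff_norm] at hx hy
  apply le_antisymm
  · obtain ⟨u, hu, hxu, hy'⟩ :=
      exists_eq_cos_smul_add_sin_smul hx hy (exists_unit_orthogonal hl hx)
    conv_lhs => rw [hy']
    refine lengthEDist_cos_sin_le (InnerProductGeometry.angle_nonneg x y) (fun t => ?_) fun t => ?_
    · exact mem_sphere_zero_iff_norm.2 (norm_cos_smul_add_sin_smul hx hu hxu t)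
    · rw [euclideanTensor, real_inner_self_eq_norm_sq,
        norm_smul_neg_sin_smul_add_cos_smul hx hu hxu]
  · exact angle_le_lengthEDist (ContinuousLinearMap.id ℝ _)
      (fun x hx => mem_sphere_zero_iff_norm.1 hx)
      (fun γ _ _ t _ => real_inner_self_eq_norm_sq _) x y

end Sphere

/-! ### Hurwitz forms as linear isometric embeddings -/

section Hurwitz

variable {m p : ℕ} {A : Fin p → Matrix (Fin m) (Fin m) ℝ}

/-- Polarization turns the quadratic identity into a bilinear one, which on pairs of standard basis
vectors gives the matrix entries. -/
theorem transpose_mul_self_eq_smul_one {B : Matrix (Fin m) (Fin m) ℝ} {c : ℝ}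
    (h : ∀ y, (B *ᵥ y) ⬝ᵥ (B *ᵥ y) = c * (y ⬝ᵥ y)) : Bᵀ * B = c • (1 : Matrix (Fin m) (Fin m) ℝ) := by
  have hpol : ∀ y z, (B *ᵥ y) ⬝ᵥ (B *ᵥ z) = c * (y ⬝ᵥ z) := fun y z => by
    have h1 := h (y + z)
    simp only [Matrix.mulVec_add, add_dotProduct, dotProduct_add, h y, h z] at h1
    rw [dotProduct_comm (B *ᵥ z), dotProduct_comm z y] at h1
    linarith
  ext i j
  have := hpol (Pi.single i 1) (Pi.single j 1)
  rw [Matrix.mulVec_single_one, Matrix.mulVec_single_one] at this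
  rw [Matrix.mul_apply, Matrix.smul_apply, Matrix.one_apply]
  simpa [dotProduct, Pi.single_apply, Matrix.col_apply, eq_comm] using this

/-- The map `x ↦ ∑ j, x_j A_j` as a continuous linear map. -/
noncomputable def radonCLM (A : Fin p → Matrix (Fin m) (Fin m) ℝ) :
    EuclideanSpace ℝ (Fin p) →L[ℝ] Matrix (Fin m) (Fin m) ℝ :=
  LinearMap.toContinuousLinearMap
    { toFun := radonMap A
      map_add' := fun x y => by simp [radonMap, add_smul, Finset.sum_add_distrib]
      map_smul' := fun c x => by simp [radonMap, mul_smul, Finset.smul_sum] }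

theorem radonCLM_apply (A : Fin p → Matrix (Fin m) (Fin m) ℝ) (x : EuclideanSpace ℝ (Fin p)) :
    radonCLM A x = radonMap A x := rfl

theorem matrixForm_eq_mulVec (A : Fin p → Matrix (Fin m) (Fin m) ℝ) (x : EuclideanSpace ℝ (Fin p))
    (y : Fin m → ℝ) : matrixForm A x y = radonMap A x *ᵥ y := by
  simp only [matrixForm, radonMap, Matrix.sum_mulVec, Matrix.smul_mulVec]

theorem isHurwitzForm_iff :
    IsHurwitzForm A ↔ ∀ x, (radonMap A x)ᵀ * radonMap A x =
      ‖x‖ ^ 2 • (1 : Matrix (Fin m) (Fin m) ℝ) := by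
  constructor
  · intro hA x
    refine transpose_mul_self_eq_smul_one fun y => ?_
    have := hA x y
    rw [matrixForm_eq_mulVec] at this
    simp only [dotProduct, ← pow_two, EuclideanSpace.real_norm_sq_eq]
    exact this.symm
  · intro h x y
    have := h (WithLp.toLp 2 x)
    have hm := matrixForm_eq_mulVec A (WithLp.toLp 2 x) y
    change matrixForm A x y = _ at hm
    have h2 : (radonMap A (WithLp.toLp 2 x) *ᵥ y) ⬝ᵥ (radonMap A (WithLp.toLp 2 x) *ᵥ y) =
        (∑ j, x j ^ 2) * (y ⬝ᵥ y) := by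
      rw [Matrix.dotProduct_mulVec, Matrix.vecMul_mulVec, this, Matrix.vecMul_smul,
        Matrix.vecMul_one, smul_dotProduct, EuclideanSpace.real_norm_sq_eq, smul_eq_mul]
    rw [hm]
    simpa only [dotProduct, ← pow_two] using h2.symm

theorem radonMap_image_unitSphere (A : Fin p → Matrix (Fin m) (Fin m) ℝ) :
    radonMap A '' unitSphere p = radonSphere A := by
  ext B
  constructor
  · rintro ⟨x, hx, rfl⟩
    refine ⟨x, ?_, rfl⟩
    rw [← EuclideanSpace.real_norm_sq_eq, mem_sphere_zero_iff_norm.1 hx, one_pow]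
  · rintro ⟨x, hx, rfl⟩
    refine ⟨WithLp.toLp 2 x, ?_, rfl⟩
    rw [← EuclideanSpace.real_norm_sq_eq (WithLp.toLp 2 x)] at hx
    exact mem_sphere_zero_iff_norm.2 ((pow_eq_one_iff_of_nonneg (norm_nonneg _) two_ne_zero).1 hx)

/-- The polarization of F(x)ᵀF(x) = |x|² I. Its trace gives the isometry property, and its case ⟪x,
y⟫ = 0 gives skew-symmetry. -/
theorem IsHurwitzForm.transpose_mul_add (hA : IsHurwitzForm A) (x y : EuclideanSpace ℝ (Fin p)) :
    (radonMap A x)ᵀ * radonMap A y + (radonMap A y)ᵀ * radonMap A x =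
      (2 * ⟪x, y⟫) • (1 : Matrix (Fin m) (Fin m) ℝ) := by
  rw [isHurwitzForm_iff] at hA
  have h := hA (x + y)
  rw [← radonCLM_apply, map_add, radonCLM_apply, radonCLM_apply, Matrix.transpose_add, add_mul,
    mul_add, mul_add, hA x, hA y, norm_add_sq_real, add_smul, add_smul] at h
  rw [← sub_eq_zero] at h ⊢
  rw [← h]
  abel

theorem IsHurwitzForm.inner_radonMap (hA : IsHurwitzForm A) (hm : m ≠ 0)
    (x y : EuclideanSpace ℝ (Fin p)) :
    ⟪matrixToEuclidean m (radonMap A x), matrixToEuclidean m (radonMap A y)⟫ = ⟪x, y⟫ := by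
  have h := congrArg Matrix.trace (hA.transpose_mul_add x y)
  have h' : ((radonMap A y)ᵀ * radonMap A x).trace = ((radonMap A x)ᵀ * radonMap A y).trace := by
    rw [← Matrix.trace_transpose, Matrix.transpose_mul, Matrix.transpose_transpose]
  rw [Matrix.trace_add, h', Matrix.trace_smul, Matrix.trace_one, Fintype.card_fin, smul_eq_mul] at h
  have hm' : (m : ℝ) ≠ 0 := Nat.cast_ne_zero.2 hm
  rw [inner_matrixToEuclidean]
  field_simp
  linarith

theorem IsHurwitzForm.radonMap_mem (hA : IsHurwitzForm A) {x : EuclideanSpace ℝ (Fin p)}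
    (hx : x ∈ unitSphere p) : radonMap A x ∈ orthogonalSet m := by
  refine (Matrix.mem_orthogonalGroup_iff' (Fin m) ℝ).2 ?_
  rw [isHurwitzForm_iff.1 hA, mem_sphere_zero_iff_norm.1 hx]
  simp

/-- For u ⟂ x the matrix F(x)ᵀF(u) is skew, so F(u) is tangent to O(m) at F(x), where the metric is
the rescaled Frobenius product that F preserves. -/
theorem IsHurwitzForm.orthogonalTensor_radonMap (hA : IsHurwitzForm A) (hm : m ≠ 0)
    {x u v : EuclideanSpace ℝ (Fin p)} (hx : x ∈ unitSphere p) (hu : ⟪x, u⟫ = 0) :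
    orthogonalTensor (radonMap A x) (radonMap A u) (radonMap A v) = ⟪u, v⟫ := by
  rw [orthogonalTensor_eq_inner
    ((Matrix.mem_orthogonalGroup_iff' (Fin m) ℝ).1 (hA.radonMap_mem hx)), hA.inner_radonMap hm]
  rw [Matrix.transpose_mul, Matrix.transpose_transpose]
  have := hA.transpose_mul_add x u
  rw [hu, mul_zero, zero_smul] at this
  exact eq_neg_of_add_eq_zero_right this

end Hurwitz

/-! ### Distances, total geodesy and isometry for the Radon sphere -/

section RadonSphere

variable {m p : ℕ} {A : Fin p → Matrix (Fin m) (Fin m) ℝ}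

theorem inner_cos_sin_eq_zero {V : Type*} [NormedAddCommGroup V] [InnerProductSpace ℝ V]
    {x u : V} (hx : ‖x‖ = 1) (hu : ‖u‖ = 1) (hxu : ⟪x, u⟫ = 0) (θ t : ℝ) :
    ⟪Real.cos t • x + Real.sin t • u, θ • (-Real.sin t • x + Real.cos t • u)⟫ = 0 := by
  simp only [inner_add_left, inner_add_right, real_inner_smul_left, real_inner_smul_right,
    real_inner_self_eq_norm_sq, hx, hu, hxu, real_inner_comm x u]
  ring

theorem IsHurwitzForm.radonSphere_subset (hA : IsHurwitzForm A) :
    radonSphere A ⊆ orthogonalSet m := by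
  rw [← radonMap_image_unitSphere]
  rintro _ ⟨x, hx, rfl⟩
  exact hA.radonMap_mem hx

theorem IsHurwitzForm.lengthEDist_radonSphere_le (hA : IsHurwitzForm A) (hm : m ≠ 0)
    {x u : EuclideanSpace ℝ (Fin p)} (hx : ‖x‖ = 1) (hu : ‖u‖ = 1) (hxu : ⟪x, u⟫ = 0) {θ : ℝ}
    (hθ : 0 ≤ θ) :
    lengthEDist orthogonalTensor (radonSphere A) (radonMap A x)
      (radonMap A (Real.cos θ • x + Real.sin θ • u)) ≤ ENNReal.ofReal θ := by
  simp only [← radonCLM_apply, map_add, map_smul]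
  refine lengthEDist_cos_sin_le hθ (fun t => ?_) fun t => ?_
  · rw [← map_smul, ← map_smul, ← map_add, ← radonMap_image_unitSphere]
    exact ⟨_, mem_sphere_zero_iff_norm.2 (norm_cos_smul_add_sin_smul hx hu hxu t), rfl⟩
  · rw [← map_smul, ← map_smul, ← map_add, ← map_smul, ← map_smul, ← map_add, ← map_smul,
      radonCLM_apply, radonCLM_apply, hA.orthogonalTensor_radonMap hm
      (mem_sphere_zero_iff_norm.2 (norm_cos_smul_add_sin_smul hx hu hxu t))
      (inner_cos_sin_eq_zero hx hu hxu θ t), real_inner_self_eq_norm_sq,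
      norm_smul_neg_sin_smul_add_cos_smul hx hu hxu]

theorem IsHurwitzForm.angle_le_orthogonalEDist (hA : IsHurwitzForm A) (hm : m ≠ 0)
    {x y : EuclideanSpace ℝ (Fin p)} (hx : ‖x‖ = 1) (hy : ‖y‖ = 1) :
    ENNReal.ofReal (InnerProductGeometry.angle x y) ≤
      orthogonalEDist (radonMap A x) (radonMap A y) := by
  have h := _root_.angle_le_orthogonalEDist hm (radonMap A x) (radonMap A y)
  rwa [InnerProductGeometry.angle, hA.inner_radonMap hm,
    norm_matrixToEuclidean_of_mem_orthogonalSet hm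
      (hA.radonMap_mem (mem_sphere_zero_iff_norm.2 hx)),
    norm_matrixToEuclidean_of_mem_orthogonalSet hm
      (hA.radonMap_mem (mem_sphere_zero_iff_norm.2 hy)), show (1 : ℝ) * 1 = ‖x‖ * ‖y‖ by rw [hx, hy],
    ← InnerProductGeometry.angle] at h

theorem lengthEDist_self {E : Type*} [NormedAddCommGroup E] [NormedSpace ℝ E]
    {g : E → E → E → ℝ} {X : Set E} {x : E} (hx : x ∈ X) (hg : g x 0 0 = 0) :
    lengthEDist g X x x = 0 := by
  refine le_antisymm ?_ (zero_le)
  unfold lengthEDist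
  refine le_trans (b := curveLength g fun _ => x) (iInf_le_of_le _ <|
    iInf_le_of_le contDiffOn_const <| iInf_le_of_le (fun _ _ => hx) <| iInf_le_of_le rfl <|
    iInf_le_of_le rfl le_rfl) ?_
  simp [curveLength, hg]

theorem orthogonalTensor_zero (B : Matrix (Fin m) (Fin m) ℝ) : orthogonalTensor B 0 0 = 0 := by
  simp [orthogonalTensor, soInner]

/-- Left translates of `I` and of a complex structure in `so(m)` define a Hurwitz form. -/
theorem isHurwitzForm_cons_mul {B J : Matrix (Fin m) (Fin m) ℝ} (hB : Bᵀ * B = 1) (hJ : J * J = -1)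
    (hJ' : Jᵀ = -J) : IsHurwitzForm ![B, B * J] := by
  rw [isHurwitzForm_iff]
  intro x
  have : radonMap ![B, B * J] x = B * (x 0 • 1 + x 1 • J) := by
    simp [radonMap, Fin.sum_univ_two, mul_add]
  rw [this, Matrix.transpose_mul, Matrix.mul_assoc, ← Matrix.mul_assoc Bᵀ, hB, Matrix.one_mul,
    Matrix.transpose_add, Matrix.transpose_smul, Matrix.transpose_smul, Matrix.transpose_one, hJ',
    EuclideanSpace.real_norm_sq_eq, Fin.sum_univ_two]
  simp only [add_mul, mul_add, Matrix.smul_mul, Matrix.mul_smul, Matrix.neg_mul, hJ, one_mul,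
    mul_one]
  module

theorem exists_complex_structure (n : ℕ) :
    ∃ J : Matrix (Fin (2 * n)) (Fin (2 * n)) ℝ, J * J = -1 ∧ Jᵀ = -J := by
  let e : Fin n ⊕ Fin n ≃ Fin (2 * n) := finSumFinEquiv.trans (finCongr (two_mul n).symm)
  refine ⟨Matrix.reindex e e (Matrix.J (Fin n) ℝ), ?_, ?_⟩
  · rw [Matrix.reindex_apply, Matrix.submatrix_mul_equiv, Matrix.J_squared]
    ext i j
    simp [Matrix.one_apply]
  · rw [Matrix.transpose_reindex, Matrix.J_transpose]
    rfl

/-- The half circle cos t B + sin t BJ joins B to -B in O(2n). The even size is used here: it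
provides the complex structure J. -/
theorem orthogonalEDist_neg_le {n : ℕ} (hn : n ≠ 0) {B : Matrix (Fin (2 * n)) (Fin (2 * n)) ℝ}
    (hB : B ∈ orthogonalSet (2 * n)) : orthogonalEDist B (-B) ≤ ENNReal.ofReal Real.pi := by
  obtain ⟨J, hJ, hJ'⟩ := exists_complex_structure n
  have hA := isHurwitzForm_cons_mul ((Matrix.mem_orthogonalGroup_iff' _ ℝ).1 hB) hJ hJ'
  have h := hA.lengthEDist_radonSphere_le (by omega) (x := EuclideanSpace.single 0 1)
    (u := EuclideanSpace.single 1 1) (by simp) (by simp)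
    (by simp [EuclideanSpace.inner_single_left]) Real.pi_pos.le
  have h1 : radonMap ![B, B * J] (EuclideanSpace.single 0 1) = B := by
    simp [radonMap]
  have h2 : radonMap ![B, B * J] (Real.cos Real.pi • EuclideanSpace.single 0 1 +
      Real.sin Real.pi • EuclideanSpace.single 1 1) = -B := by
    simp [radonMap]
  rw [h1, h2] at h
  exact (lengthEDist_anti hA.radonSphere_subset _ _).trans h

variable {n l : ℕ}

theorem IsHurwitzForm.lengthEDist_radonSphere {A : Fin (l + 1) → Matrix (Fin m) (Fin m) ℝ}
    (hA : IsHurwitzForm A) (hm : m ≠ 0) (hl : 1 ≤ l) {x y : EuclideanSpace ℝ (Fin (l + 1))}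
    (hx : ‖x‖ = 1) (hy : ‖y‖ = 1) :
    lengthEDist orthogonalTensor (radonSphere A) (radonMap A x) (radonMap A y) =
      ENNReal.ofReal (InnerProductGeometry.angle x y) := by
  apply le_antisymm
  · obtain ⟨u, hu, hxu, hy'⟩ :=
      exists_eq_cos_smul_add_sin_smul hx hy (exists_unit_orthogonal hl hx)
    conv_lhs => rw [hy']
    exact hA.lengthEDist_radonSphere_le hm hx hu hxu (InnerProductGeometry.angle_nonneg x y)
  · exact (hA.angle_le_orthogonalEDist hm hx hy).trans
      (lengthEDist_anti hA.radonSphere_subset _ _)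

theorem eq_or_eq_neg_of_norm_eq_one_fin_one {x y : EuclideanSpace ℝ (Fin 1)} (hx : ‖x‖ = 1)
    (hy : ‖y‖ = 1) : y = x ∨ y = -x := by
  have hx' := EuclideanSpace.real_norm_sq_eq x
  have hy' := EuclideanSpace.real_norm_sq_eq y
  rw [hx, Fin.sum_univ_one] at hx'
  rw [hy, Fin.sum_univ_one] at hy'
  rcases sq_eq_sq_iff_eq_or_eq_neg.1 (hy'.symm.trans hx') with h | h
  · left; ext i; rw [Subsingleton.elim i 0, h]
  · right; ext i; rw [Subsingleton.elim i 0, h]; rfl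

theorem IsHurwitzForm.orthogonalEDist_radonMap
    {A : Fin (l + 1) → Matrix (Fin (2 * n)) (Fin (2 * n)) ℝ} (hA : IsHurwitzForm A) (hn : n ≠ 0)
    {x y : EuclideanSpace ℝ (Fin (l + 1))} (hx : ‖x‖ = 1) (hy : ‖y‖ = 1) :
    orthogonalEDist (radonMap A x) (radonMap A y) =
      ENNReal.ofReal (InnerProductGeometry.angle x y) := by
  refine le_antisymm ?_ (hA.angle_le_orthogonalEDist (by omega) hx hy)
  -- For l = 0 the sphere is {x, -x} and contains no arc between its points, so the upper bound
  -- comes from a half circle in O(2n). For larger l the arc inside RS suffices.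
  rcases l with _ | l
  · have hO := hA.radonMap_mem (mem_sphere_zero_iff_norm.2 hx)
    have hx0 : x ≠ 0 := by rintro rfl; simp at hx
    rcases eq_or_eq_neg_of_norm_eq_one_fin_one hx hy with rfl | rfl
    · rw [orthogonalEDist, lengthEDist_self hO (orthogonalTensor_zero _)]
      exact zero_le
    · rw [InnerProductGeometry.angle_self_neg_of_nonzero hx0, ← radonCLM_apply A (-x), map_neg]
      exact orthogonalEDist_neg_le hn hO
  · rw [← hA.lengthEDist_radonSphere (by omega) (by omega) hx hy]
    exact lengthEDist_anti hA.radonSphere_subset _ _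

/-- A linear left inverse of `x ↦ ∑ j, x_j A_j`. -/
noncomputable def radonLeftInverse (A : Fin p → Matrix (Fin m) (Fin m) ℝ) :
    Matrix (Fin m) (Fin m) ℝ →L[ℝ] EuclideanSpace ℝ (Fin p) :=
  (ContinuousLinearMap.adjoint ((matrixToEuclidean m).comp (radonCLM A))).comp (matrixToEuclidean m)

/-- The adjoint of a linear isometric embedding is a left inverse of it. -/
theorem IsHurwitzForm.radonLeftInverse_radonMap (hA : IsHurwitzForm A) (hm : m ≠ 0)
    (x : EuclideanSpace ℝ (Fin p)) : radonLeftInverse A (radonMap A x) = x := by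
  refine ext_inner_right ℝ fun y => ?_
  rw [radonLeftInverse, ContinuousLinearMap.comp_apply, ContinuousLinearMap.adjoint_inner_left]
  exact hA.inner_radonMap hm x y

/-- Points of the two-point set `RS` at finite inner distance coincide. -/
theorem IsHurwitzForm.eq_of_lengthEDist_ne_top {A : Fin 1 → Matrix (Fin m) (Fin m) ℝ}
    (hA : IsHurwitzForm A) (hm : m ≠ 0) {g : Matrix (Fin m) (Fin m) ℝ → Matrix (Fin m) (Fin m) ℝ →
      Matrix (Fin m) (Fin m) ℝ → ℝ} {B C : Matrix (Fin m) (Fin m) ℝ}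
    (hBC : lengthEDist g (radonSphere A) B C ≠ ⊤) : B = C := by
  by_contra hne
  refine hBC ?_
  simp only [lengthEDist, iInf_eq_top]
  rintro γ hγ hmem rfl rfl
  refine absurd ?_ hne
  rw [← radonMap_image_unitSphere] at hmem
  have hsq : ∀ t ∈ Set.Icc (0 : ℝ) 1, radonLeftInverse A (γ t) 0 ^ 2 = 1 := fun t ht => by
    obtain ⟨x, hx, hxt⟩ := hmem t ht
    have := EuclideanSpace.real_norm_sq_eq x
    rw [mem_sphere_zero_iff_norm.1 hx, Fin.sum_univ_one] at this
    rw [← hxt, hA.radonLeftInverse_radonMap hm, ← this, one_pow]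
  have hcont : ContinuousOn (fun t => radonLeftInverse A (γ t) 0) (Set.Icc 0 1) :=
    (EuclideanSpace.proj (𝕜 := ℝ) (0 : Fin 1)).continuous.comp_continuousOn
      ((radonLeftInverse A).continuous.comp_continuousOn hγ.continuousOn)
  have h0 : (0 : ℝ) ∈ Set.Icc (0 : ℝ) 1 := by simp
  have h1 : (1 : ℝ) ∈ Set.Icc (0 : ℝ) 1 := by simp
  -- The single coordinate is continuous along the curve and has square 1, so it cannot change sign
  -- on [0, 1].
  have heq := isPreconnected_Icc.eq_of_sq_eq hcont
    (continuousOn_const (c := radonLeftInverse A (γ 0) 0))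
    (fun t ht => (hsq t ht).trans (hsq 0 h0).symm)
    (fun {t} _ h => by have := hsq 0 h0; rw [h] at this; norm_num at this) h0 rfl h1
  obtain ⟨x, hx, hx0⟩ := hmem 0 h0
  obtain ⟨y, hy, hy1⟩ := hmem 1 h1
  simp only [← hx0, ← hy1, hA.radonLeftInverse_radonMap hm] at heq
  have hxy : x = y := by ext i; rw [Subsingleton.elim i 0, heq]
  rw [← hx0, ← hy1, hxy]

theorem IsHurwitzForm.isTotallyGeodesicSubmanifold_radonSphere
    {A : Fin (l + 1) → Matrix (Fin (2 * n)) (Fin (2 * n)) ℝ} (hA : IsHurwitzForm A) (hn : n ≠ 0) :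
    IsTotallyGeodesicSubmanifold l orthogonalTensor (radonSphere A) (orthogonalSet (2 * n)) := by
  refine ⟨?_, hA.radonSphere_subset, fun J γ _ hγ =>
    hγ.mono_of_lengthEDist_eq hA.radonSphere_subset fun B hB C hC hfin => ?_⟩
  · rw [← radonMap_image_unitSphere]
    exact isSmoothSubmanifold_image_sphere (by simp) (radonCLM A) (radonLeftInverse A)
      (hA.radonLeftInverse_radonMap (by omega))
  · rcases l with _ | l
    -- For l = 0 the points ±B are at infinite distance in RS but at finite distance in O(2n), so
    -- distances are compared only where the former is finite.
    · obtain rfl := hA.eq_of_lengthEDist_ne_top (by omega) hfin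
      rw [lengthEDist_self hB (orthogonalTensor_zero _),
        lengthEDist_self (hA.radonSphere_subset hB) (orthogonalTensor_zero _)]
    · rw [← radonMap_image_unitSphere] at hB hC
      obtain ⟨x, hx, rfl⟩ := hB
      obtain ⟨y, hy, rfl⟩ := hC
      rw [unitSphere, mem_sphere_zero_iff_norm] at hx hy
      rw [hA.lengthEDist_radonSphere (by omega) (by omega) hx hy]
      exact hA.orthogonalEDist_radonMap hn hx hy

theorem IsTangentVector.inner_eq_zero {x u : EuclideanSpace ℝ (Fin p)}
    (h : IsTangentVector (unitSphere p) x u) : ⟪x, u⟫ = 0 := by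
  obtain ⟨γ, hγ, hmem, rfl, rfl⟩ := h
  exact inner_deriv_eq_zero_of_norm_eq_one uniqueDiffWithinAt_univ (Set.mem_univ _)
    ((hγ.differentiable (by simp)) 0).hasDerivAt.hasDerivWithinAt
    fun t _ => mem_sphere_zero_iff_norm.1 (hmem t)

theorem IsHurwitzForm.isRiemannianIsometry_radonMap (hA : IsHurwitzForm A) (hm : m ≠ 0) :
    IsRiemannianIsometry (euclideanTensor p) (unitSphere p) orthogonalTensor (radonSphere A)
      (radonMap A) where
  bijOn := by
    rw [← radonMap_image_unitSphere]
    exact (Function.LeftInverse.injective (hA.radonLeftInverse_radonMap hm)).injOn.bijOn_image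
  smooth := ⟨Set.univ, isOpen_univ, Set.subset_univ _, (radonCLM A).contDiff.contDiffOn⟩
  smooth_inverse := ⟨radonLeftInverse A, Set.univ, isOpen_univ, Set.subset_univ _,
    (radonLeftInverse A).contDiff.contDiffOn, fun x _ => hA.radonLeftInverse_radonMap hm x⟩
  metric := fun x hx u v hu _ => by
    have hd : fderiv ℝ (radonMap A) x = radonCLM A := (radonCLM A).fderiv
    exact (congrArg₂ (orthogonalTensor (radonMap A x)) (DFunLike.congr_fun hd u)
      (DFunLike.congr_fun hd v)).trans (hA.orthogonalTensor_radonMap hm hx hu.inner_eq_zero)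

end RadonSphere

/-! ### Clifford–Killing spaces and the exponential map -/

section CliffordKilling

variable {m l : ℕ}

/-- Euler's formula, carried over by the algebra map ℂ → matrices with i ↦ J, since continuous
algebra maps commute with exp. -/
theorem exp_smul_of_mul_self_eq_neg_one {J : Matrix (Fin m) (Fin m) ℝ} (hJ : J * J = -1) (t : ℝ) :
    NormedSpace.exp (t • J) = Real.cos t • (1 : Matrix (Fin m) (Fin m) ℝ) + Real.sin t • J := by
  let f : ℂ →ₐ[ℝ] Matrix (Fin m) (Fin m) ℝ := Complex.lift ⟨J, hJ⟩
  have hf : ∀ z : ℂ, f z = z.re • (1 : Matrix (Fin m) (Fin m) ℝ) + z.im • J := fun z => by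
    rw [← Algebra.algebraMap_eq_smul_one]
    exact Complex.liftAux_apply J hJ z
  have hcont : Continuous f := f.toLinearMap.continuous_of_finiteDimensional
  have h := NormedSpace.map_exp f hcont (t * Complex.I)
  rw [← Complex.exp_eq_exp_ℂ, hf, hf, Complex.exp_ofReal_mul_I_re, Complex.exp_ofReal_mul_I_im] at h
  simp only [Complex.mul_re, Complex.mul_im, Complex.ofReal_re, Complex.ofReal_im, Complex.I_re,
    Complex.I_im, mul_zero, mul_one, sub_zero, add_zero, zero_smul, zero_add] at h
  exact h.symm

theorem exp_mem_specialOrthogonalGroup {U : Matrix (Fin m) (Fin m) ℝ} (hU : Uᵀ = -U) :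
    NormedSpace.exp U ∈ Matrix.specialOrthogonalGroup (Fin m) ℝ := by
  have hO : ∀ W : Matrix (Fin m) (Fin m) ℝ, Wᵀ = -W →
      (NormedSpace.exp W)ᵀ * NormedSpace.exp W = 1 := fun W hW => by
    rw [← Matrix.exp_transpose, hW, ← Matrix.exp_add_of_commute _ _ (Commute.refl W).neg_left,
      neg_add_cancel, NormedSpace.exp_zero]
  refine Matrix.mem_specialOrthogonalGroup_iff.2
    ⟨(Matrix.mem_orthogonalGroup_iff' (Fin m) ℝ).2 (hO U hU), ?_⟩
  -- With W = U/2, det(exp W)² = 1 and exp W · exp W = exp U, so det(exp U) is exactly 1 and not -1.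
  have h := congrArg Matrix.det (hO ((1 / 2 : ℝ) • U) (by rw [Matrix.transpose_smul, hU, smul_neg]))
  rw [Matrix.det_mul, Matrix.det_transpose, Matrix.det_one, ← Matrix.det_mul,
    ← Matrix.exp_add_of_commute _ _ (Commute.refl _), ← add_smul] at h
  norm_num at h
  exact h

theorem norm_toEuclideanLin_sq (U : Matrix (Fin m) (Fin m) ℝ) (y : EuclideanSpace ℝ (Fin m)) :
    ‖Matrix.toEuclideanLin U y‖ ^ 2 = (U *ᵥ y) ⬝ᵥ (U *ᵥ y) := by
  rw [EuclideanSpace.real_norm_sq_eq]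
  simp only [dotProduct, ← pow_two]
  rfl

/-- A matrix stretches all vectors by the factor `c` if it maps the unit sphere to the sphere of
radius `c`. -/
theorem norm_toEuclideanLin_eq {U : Matrix (Fin m) (Fin m) ℝ} {c : ℝ}
    (h : ∀ y ∈ unitSphere m, ‖Matrix.toEuclideanLin U y‖ = c) (y : EuclideanSpace ℝ (Fin m)) :
    ‖Matrix.toEuclideanLin U y‖ = c * ‖y‖ := by
  by_cases hy : y = 0
  · simp [hy]
  · have hy' := norm_ne_zero_iff.2 hy
    have := h (‖y‖⁻¹ • y) (mem_sphere_zero_iff_norm.2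
      (by rw [norm_smul, norm_inv, norm_norm, inv_mul_cancel₀ hy']))
    rw [map_smul, norm_smul, norm_inv, norm_norm] at this
    rw [← this]
    field_simp

theorem transpose_mul_self_of_constant_length {U : Matrix (Fin m) (Fin m) ℝ}
    (h : HasConstantLengthOnSphere fun y => Matrix.toEuclideanLin U y)
    {e : EuclideanSpace ℝ (Fin m)} (he : ‖e‖ = 1) :
    Uᵀ * U = ‖Matrix.toEuclideanLin U e‖ ^ 2 • (1 : Matrix (Fin m) (Fin m) ℝ) := by
  obtain ⟨c, hc⟩ := h
  refine transpose_mul_self_eq_smul_one fun y => ?_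
  rw [← norm_toEuclideanLin_sq U (WithLp.toLp 2 y), norm_toEuclideanLin_eq hc,
    hc e (mem_sphere_zero_iff_norm.2 he), mul_pow, EuclideanSpace.real_norm_sq_eq]
  simp only [dotProduct, ← pow_two]

theorem inner_toEuclideanLin_of_skew {U : Matrix (Fin m) (Fin m) ℝ} (hU : Uᵀ = -U)
    (y z : EuclideanSpace ℝ (Fin m)) :
    ⟪Matrix.toEuclideanLin U y, z⟫ + ⟪y, Matrix.toEuclideanLin U z⟫ = 0 := by
  have h := Matrix.toEuclideanLin_conjTranspose_eq_adjoint U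
  rw [Matrix.conjTranspose_eq_transpose_of_trivial, hU, map_neg] at h
  rw [← LinearMap.adjoint_inner_left, ← h]
  simp

theorem isKillingFieldOnSphere_of_skew {U : Matrix (Fin m) (Fin m) ℝ} (hU : Uᵀ = -U) :
    IsKillingFieldOnSphere fun y => Matrix.toEuclideanLin U y where
  smooth := ⟨Set.univ, isOpen_univ, Set.subset_univ _,
    (LinearMap.toContinuousLinearMap (Matrix.toEuclideanLin U)).contDiff.contDiffOn⟩
  tangent := fun y _ => by
    have := inner_toEuclideanLin_of_skew hU y y
    rw [real_inner_comm] at this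
    linarith
  lie_eq_zero := fun y _ u v _ _ => by
    have hd : fderiv ℝ (fun y => Matrix.toEuclideanLin U y) y =
        LinearMap.toContinuousLinearMap (Matrix.toEuclideanLin U) :=
      (LinearMap.toContinuousLinearMap (Matrix.toEuclideanLin U)).fderiv
    rw [hd]
    exact inner_toEuclideanLin_of_skew hU u v

theorem IsHurwitzForm.linearIndependent {p : ℕ} {A : Fin p → Matrix (Fin m) (Fin m) ℝ}
    (hA : IsHurwitzForm A) (hm : m ≠ 0) : LinearIndependent ℝ A := by
  rw [Fintype.linearIndependent_iff]
  intro g hg i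
  have h := hA.radonLeftInverse_radonMap hm (WithLp.toLp 2 g)
  rw [show radonMap A (WithLp.toLp 2 g) = 0 from hg, map_zero] at h
  exact congrArg (fun v : EuclideanSpace ℝ (Fin p) => v i) h.symm

variable {A : Fin (l + 1) → Matrix (Fin m) (Fin m) ℝ}

theorem radonMap_single_last (A : Fin (l + 1) → Matrix (Fin m) (Fin m) ℝ) :
    radonMap A (EuclideanSpace.single (Fin.last l) 1) = A (Fin.last l) := by
  simp [radonMap]

theorem inner_single_last (x : EuclideanSpace ℝ (Fin (l + 1))) :
    ⟪EuclideanSpace.single (Fin.last l) 1, x⟫ = x (Fin.last l) := by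
  simp [EuclideanSpace.inner_single_left]

theorem mem_span_castSucc_iff {U : Matrix (Fin m) (Fin m) ℝ} :
    U ∈ Submodule.span ℝ (Set.range fun i : Fin l => A i.castSucc) ↔
      ∃ x : EuclideanSpace ℝ (Fin (l + 1)), x (Fin.last l) = 0 ∧ radonMap A x = U := by
  rw [Submodule.mem_span_range_iff_exists_fun]
  constructor
  · rintro ⟨c, rfl⟩
    refine ⟨WithLp.toLp 2 (Fin.snoc c 0), by simp, ?_⟩
    simp [radonMap, Fin.sum_univ_castSucc]
  · rintro ⟨x, hx, rfl⟩
    exact ⟨fun i => x i.castSucc, by simp [radonMap, Fin.sum_univ_castSucc, hx]⟩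

/-- Polarize against the last basis vector, whose image is I: orthogonality to it reads F(x) + F(x)ᵀ
= 0. -/
theorem IsHurwitzForm.transpose_radonMap (hA : IsHurwitzForm A) (h1 : A (Fin.last l) = 1)
    {x : EuclideanSpace ℝ (Fin (l + 1))} (hx : x (Fin.last l) = 0) :
    (radonMap A x)ᵀ = -radonMap A x := by
  have h := hA.transpose_mul_add (EuclideanSpace.single (Fin.last l) 1) x
  rw [radonMap_single_last, h1, inner_single_last, hx, Matrix.transpose_one, one_mul, mul_one,
    mul_zero, zero_smul] at h
  exact eq_neg_of_add_eq_zero_right h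

theorem IsHurwitzForm.isCliffordKillingSpace_span (hA : IsHurwitzForm A) (hm : m ≠ 0) (hl : 1 ≤ l)
    (h1 : A (Fin.last l) = 1) :
    IsCliffordKillingSpace l (Submodule.span ℝ (Set.range fun i : Fin l => A i.castSucc)) where
  one_le := hl
  finrank_eq := by
    exact (finrank_span_eq_card (b := fun i : Fin l => A i.castSucc)
      ((hA.linearIndependent hm).comp _ (Fin.castSucc_injective l))).trans (Fintype.card_fin l)
  le_so := fun U hU => by
    obtain ⟨x, hx, rfl⟩ := mem_span_castSucc_iff.1 hU
    exact (LieAlgebra.Orthogonal.mem_so _ _ _).2 (hA.transpose_radonMap h1 hx)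
  killing := fun U hU => by
    obtain ⟨x, hx, rfl⟩ := mem_span_castSucc_iff.1 hU
    exact isKillingFieldOnSphere_of_skew (hA.transpose_radonMap h1 hx)
  constant_length := fun U hU => by
    obtain ⟨x, hx, rfl⟩ := mem_span_castSucc_iff.1 hU
    refine ⟨‖x‖, fun y hy => ?_⟩
    have h := hA x y
    rw [matrixForm_eq_mulVec, ← EuclideanSpace.real_norm_sq_eq, ← EuclideanSpace.real_norm_sq_eq,
      mem_sphere_zero_iff_norm.1 hy] at h
    have h2 : ‖Matrix.toEuclideanLin (radonMap A x) y‖ ^ 2 = ‖x‖ ^ 2 := by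
      rw [EuclideanSpace.real_norm_sq_eq, ← mul_one (‖x‖ ^ 2), ← one_pow (M := ℝ) 2, h]
      rfl
    exact (pow_left_inj₀ (norm_nonneg _) (norm_nonneg _) two_ne_zero).1 h2

theorem IsHurwitzForm.exp_radonMap (hA : IsHurwitzForm A) (h1 : A (Fin.last l) = 1)
    {z : EuclideanSpace ℝ (Fin (l + 1))} (hz : ‖z‖ = 1) (hz0 : z (Fin.last l) = 0) (t : ℝ) :
    NormedSpace.exp (radonMap A (t • z)) =
      radonMap A (Real.cos t • EuclideanSpace.single (Fin.last l) 1 + Real.sin t • z) := by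
  have hJ : radonMap A z * radonMap A z = -1 := by
    have h := isHurwitzForm_iff.1 hA z
    rw [hA.transpose_radonMap h1 hz0, hz, one_pow, one_smul, neg_mul] at h
    rw [← h, neg_neg]
  rw [← radonCLM_apply, ← radonCLM_apply, map_add, map_smul, map_smul, map_smul, radonCLM_apply,
    radonCLM_apply, radonMap_single_last, h1]
  exact exp_smul_of_mul_self_eq_neg_one hJ t

theorem IsHurwitzForm.radonSphere_eq_expImage (hA : IsHurwitzForm A) (hl : 1 ≤ l)
    (h1 : A (Fin.last l) = 1) :
    radonSphere A = expImage (Submodule.span ℝ (Set.range fun i : Fin l => A i.castSucc)) := by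
  have he : ‖(EuclideanSpace.single (Fin.last l) 1 : EuclideanSpace ℝ (Fin (l + 1)))‖ = 1 := by simp
  rw [← radonMap_image_unitSphere]
  ext B
  constructor
  · rintro ⟨y, hy, rfl⟩
    -- Each point of the sphere lies on a great circle through the last basis vector, the preimage
    -- of I; Euler's formula identifies its image with a one-parameter group.
    obtain ⟨z, hz, hez, hy'⟩ := exists_eq_cos_smul_add_sin_smul he (mem_sphere_zero_iff_norm.1 hy)
      (exists_unit_orthogonal hl he)
    rw [inner_single_last] at hez
    rw [hy', ← hA.exp_radonMap h1 hz hez]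
    exact ⟨_, mem_span_castSucc_iff.2 ⟨_, by simp [hez], rfl⟩, rfl⟩
  · rintro ⟨U, hU, rfl⟩
    obtain ⟨x, hx, rfl⟩ := mem_span_castSucc_iff.1 hU
    obtain ⟨t, z, hz, hez, rfl⟩ : ∃ (t : ℝ) (z : EuclideanSpace ℝ (Fin (l + 1))), ‖z‖ = 1 ∧
        z (Fin.last l) = 0 ∧ x = t • z := by
      by_cases hx0 : x = 0
      · obtain ⟨z, hz, hez⟩ := exists_unit_orthogonal hl he
        exact ⟨0, z, hz, by rwa [inner_single_last] at hez, by simp [hx0]⟩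
      · have hx' := norm_ne_zero_iff.2 hx0
        refine ⟨‖x‖, ‖x‖⁻¹ • x, ?_, by simp [hx], ?_⟩
        · rw [norm_smul, norm_inv, norm_norm, inv_mul_cancel₀ hx']
        · rw [smul_smul, mul_inv_cancel₀ hx', one_smul]
    rw [hA.exp_radonMap h1 hz hez]
    exact ⟨_, mem_sphere_zero_iff_norm.2
      (norm_cos_smul_add_sin_smul he hz (by rw [inner_single_last, hez]) t), rfl⟩

/-- Evaluation at a unit vector is injective on a Clifford-Killing space; the preimages of an
orthonormal basis of its range complete the identity matrix to a Hurwitz form. -/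
theorem IsCliffordKillingSpace.exists_isHurwitzForm (hm : m ≠ 0)
    {V : Submodule ℝ (Matrix (Fin m) (Fin m) ℝ)} (hV : IsCliffordKillingSpace l V) :
    ∃ A : Fin (l + 1) → Matrix (Fin m) (Fin m) ℝ, IsHurwitzForm A ∧ A (Fin.last l) = 1 ∧
      Submodule.span ℝ (Set.range fun i : Fin l => A i.castSucc) = V := by
  let e : EuclideanSpace ℝ (Fin m) := EuclideanSpace.single ⟨0, Nat.pos_of_ne_zero hm⟩ 1
  have he : ‖e‖ = 1 := by simp [e]
  have hsq : ∀ U ∈ V, Uᵀ * U = ‖Matrix.toEuclideanLin U e‖ ^ 2 • (1 : Matrix (Fin m) (Fin m) ℝ) :=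
    fun U hU => transpose_mul_self_of_constant_length (hV.constant_length U hU) he
  let ev : V →ₗ[ℝ] EuclideanSpace ℝ (Fin m) :=
    ((LinearMap.applyₗ e).comp Matrix.toEuclideanLin.toLinearMap).comp V.subtype
  have hev : ∀ U : V, ev U = Matrix.toEuclideanLin (U : Matrix (Fin m) (Fin m) ℝ) e := fun _ => rfl
  have hinj : Function.Injective ev := by
    rw [injective_iff_map_eq_zero]
    intro U hU
    have h := hsq U U.2
    rw [← hev, hU, norm_zero, zero_pow two_ne_zero, zero_smul,
      ← Matrix.conjTranspose_eq_transpose_of_trivial] at h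
    exact Subtype.ext (Matrix.conjTranspose_mul_self_eq_zero.1 h)
  let E := LinearEquiv.ofInjective ev hinj
  have hfin : Module.finrank ℝ (LinearMap.range ev) = l := by
    rw [LinearMap.finrank_range_of_inj hinj, hV.finrank_eq]
  let b : OrthonormalBasis (Fin l) ℝ (LinearMap.range ev) :=
    (stdOrthonormalBasis ℝ _).reindex (finCongr hfin)
  let a : Fin l → V := fun i => E.symm (b i)
  have ha : ∀ i, ev (a i) = b i := fun i =>
    congrArg Subtype.val (E.apply_symm_apply (b i))
  let A : Fin (l + 1) → Matrix (Fin m) (Fin m) ℝ := Fin.snoc (fun i => (a i : Matrix _ _ ℝ)) 1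
  have hlast : A (Fin.last l) = 1 := Fin.snoc_last _ _
  have hcast : ∀ i : Fin l, A i.castSucc = a i := fun i => Fin.snoc_castSucc _ _ _
  have hA : IsHurwitzForm A := by
    rw [isHurwitzForm_iff]
    intro x
    let U : V := ∑ i : Fin l, x i.castSucc • a i
    have hU : radonMap A x = (U : Matrix (Fin m) (Fin m) ℝ) + x (Fin.last l) • 1 := by
      simp [radonMap, Fin.sum_univ_castSucc, hlast, hcast, U]
    have hskew : (U : Matrix (Fin m) (Fin m) ℝ)ᵀ = -U :=
      (LieAlgebra.Orthogonal.mem_so _ _ _).1 (hV.le_so U U.2)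
    have hnorm : ‖ev U‖ ^ 2 = ∑ i : Fin l, x i.castSucc ^ 2 := by
      have : ev U = ((∑ i : Fin l, x i.castSucc • b i : LinearMap.range ev) :
          EuclideanSpace ℝ (Fin m)) := by
        simp [U, ha]
      rw [this, ← Submodule.coe_norm, ← b.sum_sq_norm_inner_right]
      refine Finset.sum_congr rfl fun i _ => ?_
      rw [b.orthonormal.inner_right_fintype, Real.norm_eq_abs, sq_abs]
    have h := hsq U U.2
    rw [← hev, hnorm] at h
    -- In (U + cI)ᵀ(U + cI) the cross terms c(Uᵀ + U) cancel by skewness, leaving UᵀU + c² I.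
    rw [hU, EuclideanSpace.real_norm_sq_eq, Fin.sum_univ_castSucc, add_smul, ← h,
      Matrix.transpose_add, Matrix.transpose_smul, Matrix.transpose_one, hskew]
    simp only [add_mul, mul_add, Matrix.smul_mul, Matrix.mul_smul, one_mul, mul_one]
    module
  refine ⟨A, hA, hlast, ?_⟩
  -- The span of the new matrices is itself a Clifford–Killing space, hence of dimension l; being
  -- contained in V, it equals V.
  have hfinV := (hA.isCliffordKillingSpace_span hm hV.one_le hlast).finrank_eq
  refine Submodule.eq_of_le_of_finrank_eq ?_ (hfinV.trans hV.finrank_eq.symm)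
  rw [Submodule.span_le]
  rintro _ ⟨i, rfl⟩
  simp only [hcast]
  exact (a i).2

end CliffordKilling

theorem theorem18 (n l : ℕ) (hn : 1 ≤ n) :
    (∀ A : Fin (l + 1) → Matrix (Fin (2 * n)) (Fin (2 * n)) ℝ, IsHurwitzForm A →
      -- the map takes values in `O(2n)`, preserves distances, and has the image `RS`
      ((∀ x ∈ unitSphere (l + 1), radonMap A x ∈ orthogonalSet (2 * n)) ∧
        (∀ x ∈ unitSphere (l + 1), ∀ y ∈ unitSphere (l + 1),
          orthogonalEDist (radonMap A x) (radonMap A y) =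
            ENNReal.ofReal (InnerProductGeometry.angle x y)) ∧
        (1 ≤ l → ∀ x ∈ unitSphere (l + 1), ∀ y ∈ unitSphere (l + 1),
          orthogonalEDist (radonMap A x) (radonMap A y) =
            lengthEDist (euclideanTensor (l + 1)) (unitSphere (l + 1)) x y) ∧
        radonMap A '' unitSphere (l + 1) = radonSphere A) ∧
      -- `RS` is a totally geodesic submanifold, isometric to the standard unit sphere `S^l`
      (IsTotallyGeodesicSubmanifold l orthogonalTensor (radonSphere A) (orthogonalSet (2 * n)) ∧
        IsRiemannianIsometry (euclideanTensor (l + 1)) (unitSphere (l + 1))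
          orthogonalTensor (radonSphere A) (radonMap A)) ∧
      -- if `A_p = I`, then `RS` is the image of a Clifford-Killing space
      (1 ≤ l → A (Fin.last l) = 1 →
        IsCliffordKillingSpace l (Submodule.span ℝ (Set.range fun i : Fin l => A i.castSucc)) ∧
        radonSphere A =
          expImage (Submodule.span ℝ (Set.range fun i : Fin l => A i.castSucc)))) ∧
    -- conversely, the image of every Clifford-Killing space is a Radon sphere with `A_p = I`
    (∀ V : Submodule ℝ (Matrix (Fin (2 * n)) (Fin (2 * n)) ℝ), IsCliffordKillingSpace l V →
      expImage V ⊆ Matrix.specialOrthogonalGroup (Fin (2 * n)) ℝ ∧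
      ∃ A : Fin (l + 1) → Matrix (Fin (2 * n)) (Fin (2 * n)) ℝ,
        IsHurwitzForm A ∧ A (Fin.last l) = 1 ∧ expImage V = radonSphere A) := by
  have hn' : n ≠ 0 := by omega
  have hm : 2 * n ≠ 0 := by omega
  refine ⟨fun A hA => ⟨⟨fun x hx => hA.radonMap_mem hx, fun x hx y hy => ?_, fun hl x hx y hy => ?_,
    radonMap_image_unitSphere A⟩, ⟨hA.isTotallyGeodesicSubmanifold_radonSphere hn',
    hA.isRiemannianIsometry_radonMap hm⟩, fun hl h1 =>
    ⟨hA.isCliffordKillingSpace_span hm hl h1, hA.radonSphere_eq_expImage hl h1⟩⟩,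
    fun V hV => ⟨?_, ?_⟩⟩
  · exact hA.orthogonalEDist_radonMap hn' (mem_sphere_zero_iff_norm.1 hx)
      (mem_sphere_zero_iff_norm.1 hy)
  · rw [lengthEDist_unitSphere hl hx hy]
    exact hA.orthogonalEDist_radonMap hn' (mem_sphere_zero_iff_norm.1 hx)
      (mem_sphere_zero_iff_norm.1 hy)
  · rintro _ ⟨U, hU, rfl⟩
    exact exp_mem_specialOrthogonalGroup
      ((LieAlgebra.Orthogonal.mem_so _ _ _).1 (hV.le_so U hU))
  · obtain ⟨A, hA, h1, hspan⟩ := hV.exists_isHurwitzForm hm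
    exact ⟨A, hA, h1, by rw [hA.radonSphere_eq_expImage hV.one_le h1, hspan]⟩
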